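/- Fix $\epsilon\in(0,1)$, $\alpha\in(0,1)$, $K\in\mathbb N$ and constants $0<N_0\le N_1<\infty$. For each $n$ let $A_n$ be a random $n\times n$ adjacency matrix with mutually independent entries $A_{n,ij}\sim\mathrm{Poisson}(M_{n,ij})$, where $N_0\le M_{n,ij}\le N_1$ for all $n,i,j$. Given $A_n$, draw independent entries $A^{\mathrm{tr}}_{n,ij}\mid A_n\sim\mathrm{Binomial}(A_{n,ij},\epsilon)$ and put $A^{\mathrm{te}}_n:=A_n-A^{\mathrm{tr}}_n$. Let $\hat Z_n\in\{0,1\}^{n\times K}$ be an estimated community membership matrix (each node $i$ belongs to exactly one community $k$, namely the one with $\hat Z_{n,ik}=1$) that is a measurable function of $A^{\mathrm{tr}}_n$ and possibly of auxiliary randomness independent of $(A_n,A^{\mathrm{tr}}_n)$. Let $u_n\in\mathbb R^{K^2}$ with $\|u_n\|_2=1$ be a function of $A^{\mathrm{tr}}_n$ and $\hat Z_n$. Define $$\theta_n(A_n^{\mathrm{tr}}):=u_n^\top\operatorname{vec}\!\Big((\hat Z_n^\top\hat Z_n)^{-1}\hat Z_n^\top\,\mathbb E[A_n]\,\hat Z_n(\hat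 Z_n^\top\hat Z_n)^{-1}\Big),$$ $$\hat\theta_n:=(1-\epsilon)^{-1}u_n^\top\operatorname{vec}\!\Big((\hat Z_n^\top\hat Z_n)^{-1}\hat Z_n^\top A^{\mathrm{te}}_n\hat Z_n(\hat Z_n^\top\hat Z_n)^{-1}\Big),$$ and, for $k,\ell\in\{1,\dots,K\}$, $\mathcal I_{n,k\ell}:=\{(i,j):\hat Z_{n,ik}=1,\ \hat Z_{n,j\ell}=1\}$, $\hat B_{n,k\ell}:=|\mathcal I_{n,k\ell}|^{-1}\sum_{(i,j)\in\mathcal I_{n,k\ell}}A^{\mathrm{te}}_{n,ij}$, $\hat\Delta_{n,k\ell}:=\hat B_{n,k\ell}/|\mathcal I_{n,k\ell}|$ and $\hat\sigma_n^2:=(1-\epsilon)^{-2}u_n^\top\operatorname{diag}(\operatorname{vec}(\hat\Delta_n))u_n=(1-\epsilon)^{-2}\sum_{k,\ell}u_{n,k\ell}^2\,\hat B_{n,k\ell}/|\mathcal I_{n,k\ell}|$. Let $\phi_{1-\alpha/2}$ be the $(1-\alpha/2)$-quantile of $\mathcal N(0,1)$. Then, for every sequence of realizations $(a_n,\hat z_n)_n$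 of $(A^{\mathrm{tr}}_n,\hat Z_n)$, each having positive probability, such that for all $k,\ell$ the blocks $\mathcal I_{n,k\ell}$ determined by $\hat z_n$ are non-empty for all large $n$ and satisfy $|\mathcal I_{n,k\ell}|^{-1}=O(n^{-2})$, $$\lim_{n\to\infty}P\Big(\theta_n(A_n^{\mathrm{tr}})\in\big[\hat\theta_n-\phi_{1-\alpha/2}\hat\sigma_n,\ \hat\theta_n+\phi_{1-\alpha/2}\hat\sigma_n\big]\ \Big|\ A_n^{\mathrm{tr}}=a_n,\ \hat Z_n=\hat z_n\Big)=1-\alpha .$$ -/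

import Mathlib

open MeasureTheory ProbabilityTheory Filter Topology Asymptotics
open scoped NNReal ENNReal Matrix unitInterval

noncomputable section

namespace NetworkInference

/-- Adjacency matrices of networks on `n` nodes with counts as edges. -/
abbrev Network (n : ℕ) : Type := Fin n → Fin n → ℕ

/-- The `p`-quantile of the standard normal distribution. -/
def stdNormalQuantile (p : ℝ) : ℝ := sInf {x : ℝ | p ≤ cdf (gaussianReal 0 1) x}

section Model

variable {Ω : Type*} [MeasurableSpace Ω]

/-- The edges `A i j` are mutually independent, and `A i j` is Poisson with mean `M i j`. -/
structure IsPoissonNetwork {n : ℕ} (P : Measure Ω) (A : Ω → Network n)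
    (M : Fin n → Fin n → ℝ≥0) : Prop where
  measurable : Measurable A
  indep : iIndepFun (fun (e : Fin n × Fin n) (ω : Ω) => A ω e.1 e.2) P
  law : ∀ i j, HasLaw (fun ω => A ω i j) (poissonMeasure (M i j)) P

/-- Given `A`, the entries of `Atr` are independent, and `Atr i j` is binomial with `A i j` trials
and success probability `ε`. -/
structure IsBinomialThinning {n : ℕ} (P : Measure Ω) (ε : I) (A Atr : Ω → Network n) : Prop where
  measurable : Measurable Atr
  law : ∀ a t : Network n, P {ω | A ω = a} ≠ 0 →
    cond P {ω | A ω = a} {ω | Atr ω = t} = ∏ i, ∏ j, binomial (a i j) ε {t i j}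

/-- The entrywise expectation of a random network. -/
def meanMatrix {n : ℕ} (P : Measure Ω) (A : Ω → Network n) : Matrix (Fin n) (Fin n) ℝ :=
  Matrix.of fun i j => ∫ ω, (A ω i j : ℝ) ∂P

end Model

/-- The difference of two networks, as a real matrix. -/
def testMatrix {n : ℕ} (a atr : Network n) : Matrix (Fin n) (Fin n) ℝ :=
  Matrix.of fun i j => (a i j : ℝ) - (atr i j : ℝ)

/-- Membership matrices: entries in `{0, 1}`, every node belongs to exactly one community. -/
def IsMembershipMatrix {n K : ℕ} (Z : Matrix (Fin n) (Fin K) ℝ) : Prop :=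
  (∀ i k, Z i k = 0 ∨ Z i k = 1) ∧ ∀ i, ∃! k, Z i k = 1

/-- The node pairs that originate in community `k` and terminate in community `l`. -/
def block {n K : ℕ} (Z : Matrix (Fin n) (Fin K) ℝ) (k l : Fin K) : Finset (Fin n × Fin n) :=
  {e : Fin n × Fin n | Z e.1 k = 1 ∧ Z e.2 l = 1}

/-- `(ZᵀZ)⁻¹ Zᵀ X Z (ZᵀZ)⁻¹`. -/
def blockProjection {n K : ℕ} (Z : Matrix (Fin n) (Fin K) ℝ) (X : Matrix (Fin n) (Fin n) ℝ) :
    Matrix (Fin K) (Fin K) ℝ :=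
  (Zᵀ * Z)⁻¹ * Zᵀ * X * Z * (Zᵀ * Z)⁻¹

/-- The selected parameter `θ = uᵀ vec((ZᵀZ)⁻¹ Zᵀ E[A] Z (ZᵀZ)⁻¹)`, where `EA` is `E[A]`. -/
def theta {n K : ℕ} (EA : Matrix (Fin n) (Fin n) ℝ) (Z : Matrix (Fin n) (Fin K) ℝ)
    (u : EuclideanSpace ℝ (Fin K × Fin K)) : ℝ :=
  u.ofLp ⬝ᵥ (blockProjection Z EA).vec

/-- The estimator `θ̂ = (1 - ε)⁻¹ uᵀ vec((ZᵀZ)⁻¹ Zᵀ Ate Z (ZᵀZ)⁻¹)`. -/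
def thetaHat {n K : ℕ} (ε : ℝ) (Ate : Matrix (Fin n) (Fin n) ℝ) (Z : Matrix (Fin n) (Fin K) ℝ)
    (u : EuclideanSpace ℝ (Fin K × Fin K)) : ℝ :=
  (1 - ε)⁻¹ * (u.ofLp ⬝ᵥ (blockProjection Z Ate).vec)

/-- The block averages `B̂ k l` of the test network. -/
def BHat {n K : ℕ} (Ate : Matrix (Fin n) (Fin n) ℝ) (Z : Matrix (Fin n) (Fin K) ℝ) :
    Matrix (Fin K) (Fin K) ℝ :=
  Matrix.of fun k l => (∑ e ∈ block Z k l, Ate e.1 e.2) / ((block Z k l).card : ℝ)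

/-- `Δ̂ k l = B̂ k l / |I k l|`. -/
def DeltaHat {n K : ℕ} (Ate : Matrix (Fin n) (Fin n) ℝ) (Z : Matrix (Fin n) (Fin K) ℝ) :
    Matrix (Fin K) (Fin K) ℝ :=
  Matrix.of fun k l => BHat Ate Z k l / ((block Z k l).card : ℝ)

/-- The variance estimator `σ̂² = (1 - ε)⁻² uᵀ diag(vec Δ̂) u`. -/
def sigmaHatSq {n K : ℕ} (ε : ℝ) (Ate : Matrix (Fin n) (Fin n) ℝ) (Z : Matrix (Fin n) (Fin K) ℝ)
    (u : EuclideanSpace ℝ (Fin K × Fin K)) : ℝ :=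
  ((1 - ε) ^ 2)⁻¹ * (u.ofLp ⬝ᵥ (Matrix.diagonal (DeltaHat Ate Z).vec *ᵥ u.ofLp))

/-- The confidence interval `[θ̂ ± φ σ̂]`, with `φ` the `(1 - α/2)`-quantile of `N(0, 1)`. -/
def waldInterval {n K : ℕ} (ε α : ℝ) (Ate : Matrix (Fin n) (Fin n) ℝ)
    (Z : Matrix (Fin n) (Fin K) ℝ) (u : EuclideanSpace ℝ (Fin K × Fin K)) : Set ℝ :=
  Set.Icc
    (thetaHat ε Ate Z u - stdNormalQuantile (1 - α / 2) * Real.sqrt (sigmaHatSq ε Ate Z u))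
    (thetaHat ε Ate Z u + stdNormalQuantile (1 - α / 2) * Real.sqrt (sigmaHatSq ε Ate Z u))

end NetworkInference

end

open NetworkInference

/-! ### Moments and characteristic functions of Poisson distributions -/

/-! The engine is Poisson thinning: conditionally on the train network and on an event of the
auxiliary randomness, the test edges are independent Poisson variables `y e` with means `r e = (1 -
ε) * M e.1 e.2` (`map_cond_thinning`). Conditioning therefore freezes the communities and `u`
without disturbing the test data.

With these frozen, `θ̂ - θ` is a weighted sum `∑ c e * (y e - r e)`. Its variance is `V = ∑ c e ^ 2
* r e`, and `σ̂² = ∑ c e ^ 2 * y e` is unbiased for `V` because a Poisson variable has equal mean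
and variance. Coverage thus becomes a statement about a studentized Poisson sum
(`cond_coverage_eq`).

Blocks of order `n ^ 2` make every `c e ^ 2` at most `d n * V` with `d n → 0`
(`edgeWeight_sq_le_mul_sum`). This one negligibility condition gives both asymptotic normality, from
the explicit Poisson characteristic function, and `σ̂² / V → 1` in probability, from Chebyshev.
`tendsto_weighted_poisson_sum_studentized` combines the two by a sandwich argument. -/

/-- Index shift: `n / n!` is `1 / (n - 1)!`, which releases one factor `r`. Iterating it yields the
first two moments. -/
lemma hasSum_poisson_weight_mul_id (r : ℝ≥0) {f : ℕ → ℝ} {s : ℝ}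
    (hf : HasSum (fun n : ℕ => Real.exp (-r) * r ^ n / n.factorial * f (n + 1)) s) :
    HasSum (fun n : ℕ => Real.exp (-r) * r ^ n / n.factorial * (n * f n)) (r * s) := by
  rw [← hasSum_nat_add_iff' 1]
  simp only [Finset.range_one, Finset.sum_singleton, Nat.cast_zero, zero_mul, mul_zero, sub_zero]
  refine (hf.mul_left (r : ℝ)).congr_fun fun n => ?_
  rw [Nat.factorial_succ]
  push_cast
  field_simp
  ring

lemma hasSum_poisson_mean (r : ℝ≥0) :
    HasSum (fun n : ℕ => Real.exp (-r) * r ^ n / n.factorial * (n : ℝ)) r := by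
  have h := hasSum_poisson_weight_mul_id r (f := fun _ => 1) (s := 1)
    (by simpa using hasSum_one_poissonMeasure r)
  simpa using h

lemma hasSum_poisson_sq (r : ℝ≥0) :
    HasSum (fun n : ℕ => Real.exp (-r) * r ^ n / n.factorial * (n : ℝ) ^ 2) (r * (r + 1)) := by
  simp_rw [pow_two (Nat.cast _ : ℝ)]
  refine hasSum_poisson_weight_mul_id r (f := fun n => (n : ℝ)) ?_
  simpa [mul_add] using (hasSum_poisson_mean r).add (hasSum_one_poissonMeasure r)

lemma integrable_natCast_poissonMeasure (r : ℝ≥0) :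
    Integrable (fun n : ℕ => (n : ℝ)) (poissonMeasure r) := by
  rw [integrable_poissonMeasure_iff]
  simpa using (hasSum_poisson_mean r).summable

lemma integral_natCast_poissonMeasure (r : ℝ≥0) :
    ∫ n : ℕ, (n : ℝ) ∂(poissonMeasure r) = r :=
  (hasSum_integral_poissonMeasure (integrable_natCast_poissonMeasure r)).unique
    (hasSum_poisson_mean r)

lemma integrable_natCast_sq_poissonMeasure (r : ℝ≥0) :
    Integrable (fun n : ℕ => (n : ℝ) ^ 2) (poissonMeasure r) := by
  rw [integrable_poissonMeasure_iff]
  simpa using (hasSum_poisson_sq r).summable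

lemma integral_natCast_sq_poissonMeasure (r : ℝ≥0) :
    ∫ n : ℕ, (n : ℝ) ^ 2 ∂(poissonMeasure r) = r * (r + 1) :=
  (hasSum_integral_poissonMeasure (integrable_natCast_sq_poissonMeasure r)).unique
    (hasSum_poisson_sq r)

lemma memLp_natCast_poissonMeasure (r : ℝ≥0) :
    MemLp (fun n : ℕ => (n : ℝ)) 2 (poissonMeasure r) :=
  (memLp_two_iff_integrable_sq Measurable.of_discrete.aestronglyMeasurable).2
    (integrable_natCast_sq_poissonMeasure r)

lemma variance_natCast_poissonMeasure (r : ℝ≥0) :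
    variance (fun n : ℕ => (n : ℝ)) (poissonMeasure r) = r := by
  rw [variance_eq_sub (memLp_natCast_poissonMeasure r), integral_natCast_poissonMeasure]
  simp only [Pi.pow_apply]
  rw [integral_natCast_sq_poissonMeasure]
  ring

lemma integral_cexp_centered_poissonMeasure (r : ℝ≥0) (t : ℝ) :
    ∫ n : ℕ, Complex.exp ((t * ((n : ℝ) - r) : ℝ) * Complex.I) ∂(poissonMeasure r)
      = Complex.exp (r * (Complex.exp (t * Complex.I) - 1 - t * Complex.I)) := by
  have h := charFun_map_cast_poissonMeasure r t
  rw [charFun_apply, integral_map .of_discrete (by fun_prop)] at h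
  simp_rw [Real.inner_apply] at h
  have h2 : ∀ n : ℕ, Complex.exp ((t * ((n : ℝ) - r) : ℝ) * Complex.I)
      = Complex.exp (-(r * (t * Complex.I))) * Complex.exp ((((n : ℝ) * t : ℝ) : ℂ) * Complex.I) := by
    intro n
    rw [← Complex.exp_add]
    congr 1
    push_cast
    ring
  simp_rw [h2]
  rw [integral_const_mul, h, ← Complex.exp_add]
  congr 1
  ring

lemma norm_cexp_sub_quadratic_le {x : ℝ} (hx : |x| ≤ 1) :
    ‖Complex.exp (x * Complex.I) - 1 - x * Complex.I + (x : ℂ) ^ 2 / 2‖ ≤ |x| ^ 3 := by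
  have hn : ‖(x * Complex.I : ℂ)‖ = |x| := by simp
  have h := Complex.exp_bound (x := x * Complex.I) (by rwa [hn]) (n := 3) (by norm_num)
  rw [hn] at h
  calc _ = ‖Complex.exp (x * Complex.I)
        - ∑ m ∈ Finset.range 3, (x * Complex.I) ^ m / m.factorial‖ := by
        congr 1
        simp [Finset.sum_range_succ, Nat.factorial, mul_pow]
        ring
    _ ≤ _ := h
    -- The constant from `Complex.exp_bound` is `4 / (3! * 3) = 2 / 9`.
    _ ≤ |x| ^ 3 * 1 := by
        gcongr
        norm_num [Nat.factorial]
    _ = _ := mul_one _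

/-! ### Weighted sums of independent Poisson variables -/

section PoissonSum

variable {ι : Type*} [Fintype ι]

lemma charFun_map_weighted_centered_poisson (r : ι → ℝ≥0) (c : ι → ℝ) (t : ℝ) :
    charFun ((Measure.pi fun i => poissonMeasure (r i)).map
        fun y => ∑ i, c i * ((y i : ℝ) - r i)) t
      = Complex.exp (∑ i, r i * (Complex.exp ((t * c i : ℝ) * Complex.I) - 1
          - (t * c i : ℝ) * Complex.I)) := by
  rw [charFun_apply, integral_map Measurable.of_discrete.aemeasurable (by fun_prop),
    Complex.exp_sum]
  simp_rw [← integral_cexp_centered_poissonMeasure]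
  rw [← integral_fintype_prod_eq_prod
    (f := fun i (n : ℕ) => Complex.exp ((t * c i * ((n : ℝ) - r i) : ℝ) * Complex.I))]
  congr 1 with y
  rw [← Complex.exp_sum, Real.inner_apply, Finset.sum_mul, Complex.ofReal_sum, Finset.sum_mul]
  congr 1
  refine Finset.sum_congr rfl fun i _ => ?_
  push_cast
  ring

lemma integral_weighted_poisson_sum (r : ι → ℝ≥0) (c : ι → ℝ) :
    ∫ y, ∑ i, c i * (y i : ℝ) ∂(Measure.pi fun i => poissonMeasure (r i)) = ∑ i, c i * r i := by
  rw [integral_finsetSum]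
  · refine Finset.sum_congr rfl fun i _ => ?_
    rw [integral_const_mul,
      integral_comp_eval (μ := fun i => poissonMeasure (r i)) (i := i) (f := fun n : ℕ => (n : ℝ))
        Measurable.of_discrete.aestronglyMeasurable,
      integral_natCast_poissonMeasure]
  · intro i _
    exact (integrable_comp_eval (μ := fun i => poissonMeasure (r i)) (i := i)
      (integrable_natCast_poissonMeasure (r i))).const_mul _

lemma variance_weighted_poisson_sum (r : ι → ℝ≥0) (c : ι → ℝ) :
    variance (fun y => ∑ i, c i * (y i : ℝ)) (Measure.pi fun i => poissonMeasure (r i))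
      = ∑ i, c i ^ 2 * r i := by
  have h := variance_sum_pi (μ := fun i => poissonMeasure (r i))
    (X := fun i (n : ℕ) => c i * (n : ℝ)) fun i => (memLp_natCast_poissonMeasure (r i)).const_mul (c i)
  simp_rw [variance_const_mul, variance_natCast_poissonMeasure] at h
  rw [← h]
  congr 1
  ext y
  simp

lemma memLp_weighted_poisson_sum (r : ι → ℝ≥0) (c : ι → ℝ) :
    MemLp (fun y => ∑ i, c i * (y i : ℝ)) 2 (Measure.pi fun i => poissonMeasure (r i)) := by
  refine memLp_finsetSum _ fun i _ => ?_
  exact ((memLp_natCast_poissonMeasure (r i)).const_mul (c i)).comp_measurePreserving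
    (measurePreserving_eval (fun i => poissonMeasure (r i)) i)

/-- Chebyshev's inequality for the ratio of a weighted Poisson sum to its mean. -/
lemma weighted_poisson_sum_concentration (r : ι → ℝ≥0) (c : ι → ℝ) {d η : ℝ}
    (hpos : 0 < ∑ i, c i ^ 2 * r i) (hc : ∀ i, c i ^ 2 ≤ d * ∑ i, c i ^ 2 * r i) (hη : 0 < η) :
    (Measure.pi fun i => poissonMeasure (r i)).real
      {y | η * ∑ i, c i ^ 2 * r i ≤ |∑ i, c i ^ 2 * (y i : ℝ) - ∑ i, c i ^ 2 * r i|}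
      ≤ d / η ^ 2 := by
  set V := ∑ i, c i ^ 2 * (r i : ℝ) with hV
  have h := meas_ge_le_variance_div_sq (memLp_weighted_poisson_sum r fun i => c i ^ 2)
    (mul_pos hη hpos)
  rw [integral_weighted_poisson_sum, variance_weighted_poisson_sum] at h
  -- The left side is the variance of the estimator of `V`; negligibility of each `c i ^ 2` makes it
  -- small compared with `V ^ 2`.
  have hle : ∑ i, (c i ^ 2) ^ 2 * (r i : ℝ) ≤ d * V * V := by
    rw [hV, Finset.mul_sum, ← hV]
    refine Finset.sum_le_sum fun i _ => ?_
    calc (c i ^ 2) ^ 2 * (r i : ℝ) = c i ^ 2 * (c i ^ 2 * r i) := by ring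
      _ ≤ (d * V) * (c i ^ 2 * r i) := by
        gcongr
        exact hc i
  have h0 : 0 ≤ ∑ i, (c i ^ 2) ^ 2 * (r i : ℝ) := by positivity
  refine (ENNReal.toReal_mono ENNReal.ofReal_ne_top h).trans ?_
  rw [ENNReal.toReal_ofReal (by positivity), div_le_div_iff₀ (by positivity) (by positivity)]
  calc _ ≤ d * V * V * η ^ 2 := by gcongr
    _ = _ := by ring

/-- The quadratic Taylor terms add up to `-t ^ 2 / 2` by the normalization `hsum`. Each cubic
remainder loses one factor `|t * c i| ≤ b`, leaving a quadratic sum that is normalized again. -/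
lemma norm_poisson_exponent_add_le (r : ι → ℝ≥0) (c : ι → ℝ) {t b : ℝ}
    (hsum : ∑ i, c i ^ 2 * (r i : ℝ) = 1) (hb : b ≤ 1) (hc : ∀ i, |t * c i| ≤ b) :
    ‖(∑ i, r i * (Complex.exp ((t * c i : ℝ) * Complex.I) - 1 - (t * c i : ℝ) * Complex.I))
      + (t : ℂ) ^ 2 / 2‖ ≤ b * t ^ 2 := by
  have h1 : (t : ℂ) ^ 2 / 2 = ∑ i, (r i : ℂ) * (((t * c i : ℝ) : ℂ) ^ 2 / 2) := by
    have : (t : ℂ) ^ 2 / 2 = (((∑ i, c i ^ 2 * (r i : ℝ) : ℝ)) : ℂ) * ((t : ℂ) ^ 2 / 2) := by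
      rw [hsum]; simp
    rw [this, Complex.ofReal_sum, Finset.sum_mul]
    refine Finset.sum_congr rfl fun i _ => ?_
    push_cast
    ring_nf
  rw [h1, ← Finset.sum_add_distrib]
  calc _ ≤ ∑ i, (r i : ℝ) * (b * (t * c i) ^ 2) := by
        refine norm_sum_le_of_le _ fun i _ => ?_
        rw [← mul_add, norm_mul]
        have : ‖((r i : ℝ≥0) : ℂ)‖ = r i := by simp
        rw [this]
        gcongr
        refine (norm_cexp_sub_quadratic_le ((hc i).trans hb)).trans ?_
        calc |t * c i| ^ 3 = |t * c i| * (t * c i) ^ 2 := by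
              rw [← sq_abs (t * c i)]; ring
          _ ≤ _ := by
              gcongr
              exact hc i
    _ = b * t ^ 2 * ∑ i, c i ^ 2 * (r i : ℝ) := by
        rw [Finset.mul_sum]
        exact Finset.sum_congr rfl fun i _ => by ring
    _ = _ := by rw [hsum, mul_one]

end PoissonSum

/-! ### Central limit theorem for triangular arrays of weighted Poisson variables -/

/-! ### Symmetry, continuity and quantiles of the standard normal distribution -/

lemma gaussianReal_real_Iic_neg (x : ℝ) :
    (gaussianReal 0 1).real (Set.Iic (-x)) = 1 - (gaussianReal 0 1).real (Set.Iic x) := by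
  have := nullSingletonClass_gaussianReal (μ := 0) (v := 1) one_ne_zero
  have h : (gaussianReal 0 1).real (Set.Iic (-x)) = (gaussianReal 0 1).real (Set.Ici x) := by
    conv_rhs => rw [← neg_zero, ← gaussianReal_map_neg]
    rw [map_measureReal_apply (by fun_prop) measurableSet_Ici]
    congr 1
    ext y
    simp
  rw [h, ← probReal_compl_eq_one_sub measurableSet_Iic, Set.compl_Iic]
  exact measureReal_congr Ioi_ae_eq_Ici.symm

lemma gaussianReal_real_Icc_neg_self {x : ℝ} (hx : 0 ≤ x) :
    (gaussianReal 0 1).real (Set.Icc (-x) x) = 2 * cdf (gaussianReal 0 1) x - 1 := by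
  have := nullSingletonClass_gaussianReal (μ := 0) (v := 1) one_ne_zero
  have h1 : (gaussianReal 0 1).real (Set.Icc (-x) x)
      = (gaussianReal 0 1).real (Set.Iic x \ Set.Iic (-x)) := by
    rw [Set.Iic_sdiff_Iic]
    exact measureReal_congr Ioc_ae_eq_Icc.symm
  rw [h1, measureReal_sdiff (Set.Iic_subset_Iic.2 (by linarith)) measurableSet_Iic,
    gaussianReal_real_Iic_neg, cdf_eq_real]
  ring

lemma continuous_cdf_of_nullSingleton (μ : Measure ℝ) [IsProbabilityMeasure μ]
    (h : ∀ x, μ {x} = 0) : Continuous (cdf μ) := by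
  rw [continuous_iff_continuousAt]
  intro x
  have h1 := (cdf μ).measure_singleton x
  rw [measure_cdf, h, eq_comm, ENNReal.ofReal_eq_zero, sub_nonpos] at h1
  rw [(monotone_cdf μ).continuousAt_iff_leftLim_eq_rightLim, (cdf μ).rightLim_eq]
  exact le_antisymm ((monotone_cdf μ).leftLim_le le_rfl) h1

lemma continuous_cdf_stdGaussian : Continuous (cdf (gaussianReal 0 1)) := by
  have := nullSingletonClass_gaussianReal (μ := 0) (v := 1) one_ne_zero
  exact continuous_cdf_of_nullSingleton _ fun x => measure_singleton x

/-- By continuity the superlevel set is closed and contains its infimum, which gives `≥`; strictly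
to the left the distribution function is below `p`, so its left limit gives `≤`. -/
lemma cdf_stdNormalQuantile {p : ℝ} (hp0 : 0 < p) (hp1 : p < 1) :
    cdf (gaussianReal 0 1) (stdNormalQuantile p) = p := by
  set F := cdf (gaussianReal 0 1) with hF
  have hcont : Continuous F := continuous_cdf_stdGaussian
  obtain ⟨x, hx⟩ := ((tendsto_cdf_atTop (gaussianReal 0 1)).eventually_const_lt hp1).exists
  obtain ⟨x', hx'⟩ := ((tendsto_cdf_atBot (gaussianReal 0 1)).eventually_lt_const hp0).exists
  have hne : {x : ℝ | p ≤ F x}.Nonempty := ⟨x, hx.le⟩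
  have hbdd : BddBelow {x : ℝ | p ≤ F x} := by
    refine ⟨x', fun w hw => le_of_not_gt fun hlt => ?_⟩
    exact absurd (monotone_cdf (gaussianReal 0 1) hlt.le) (not_le.2 (hx'.trans_le hw))
  have hmem : p ≤ F (stdNormalQuantile p) :=
    (isClosed_le continuous_const hcont).csInf_mem hne hbdd
  refine le_antisymm ?_ hmem
  refine le_of_tendsto (hcont.continuousWithinAt (s := Set.Iio (stdNormalQuantile p))) ?_
  filter_upwards [self_mem_nhdsWithin] with w hw
  exact (not_le.1 fun h => absurd (csInf_le hbdd h) (not_le.2 hw)).le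

lemma stdNormalQuantile_pos {p : ℝ} (hp0 : 1 / 2 < p) (hp1 : p < 1) :
    0 < stdNormalQuantile p := by
  by_contra! h
  have h1 := monotone_cdf (gaussianReal 0 1) h
  rw [cdf_stdNormalQuantile (by linarith) hp1] at h1
  have h2 := gaussianReal_real_Iic_neg 0
  rw [neg_zero, ← cdf_eq_real] at h2
  linarith

lemma gaussianReal_Icc_stdNormalQuantile {α : ℝ} (h0 : 0 < α) (h1 : α < 1) :
    (gaussianReal 0 1).real
      (Set.Icc (-stdNormalQuantile (1 - α / 2)) (stdNormalQuantile (1 - α / 2))) = 1 - α := by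
  rw [gaussianReal_real_Icc_neg_self
      (stdNormalQuantile_pos (by linarith) (by linarith)).le,
    cdf_stdNormalQuantile (by linarith) (by linarith)]
  ring

/-! ### Normal limits of standardized and studentized sums -/

section TriangularArray

variable {ι : ℕ → Type*} [∀ n, Fintype (ι n)] {r : ∀ n, ι n → ℝ≥0} {c : ∀ n, ι n → ℝ} {d : ℕ → ℝ}

lemma tendsto_charFun_weighted_poisson_sum (hd : Tendsto d atTop (𝓝 0))
    (hsum : ∀ᶠ n in atTop, ∑ i, c n i ^ 2 * (r n i : ℝ) = 1)
    (hc : ∀ᶠ n in atTop, ∀ i, c n i ^ 2 ≤ d n) (t : ℝ) :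
    Tendsto (fun n => charFun ((Measure.pi fun i => poissonMeasure (r n i)).map
        fun y => ∑ i, c n i * ((y i : ℝ) - r n i)) t) atTop
      (𝓝 (charFun (gaussianReal 0 1) t)) := by
  simp_rw [charFun_map_weighted_centered_poisson]
  rw [charFun_gaussianReal]
  refine (Complex.continuous_exp.tendsto _).comp ?_
  have hb : Tendsto (fun n => |t| * √(d n)) atTop (𝓝 0) := by
    simpa using ((Real.continuous_sqrt.tendsto 0).comp hd).const_mul |t|
  have hlim : Tendsto (fun n => |t| * √(d n) * t ^ 2) atTop (𝓝 0) := by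
    simpa using hb.mul_const (t ^ 2)
  rw [tendsto_iff_norm_sub_tendsto_zero]
  refine squeeze_zero' (.of_forall fun _ => norm_nonneg _) ?_ hlim
  filter_upwards [hsum, hc, hb.eventually_le_const one_pos] with n h1 h2 h3
  have h := norm_poisson_exponent_add_le (r n) (c n) h1 h3 (t := t) fun i => by
    rw [abs_mul]
    gcongr
    exact Real.abs_le_sqrt (h2 i)
  refine (le_of_eq ?_).trans h
  congr 1
  simp only [Complex.ofReal_zero, NNReal.coe_one, Complex.ofReal_one]
  ring

/-- Lévy's continuity theorem gives weak convergence; the portmanteau theorem applies because the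
frontier of the interval is finite, hence Gaussian-null. -/
lemma tendsto_weighted_poisson_sum_normalized (hd : Tendsto d atTop (𝓝 0))
    (hsum : ∀ᶠ n in atTop, ∑ i, c n i ^ 2 * (r n i : ℝ) = 1)
    (hc : ∀ᶠ n in atTop, ∀ i, c n i ^ 2 ≤ d n) (x : ℝ) :
    Tendsto (fun n => (Measure.pi fun i => poissonMeasure (r n i)).real
        {y | |∑ i, c n i * ((y i : ℝ) - r n i)| ≤ x}) atTop
      (𝓝 ((gaussianReal 0 1).real (Set.Icc (-x) x))) := by
  have hna := nullSingletonClass_gaussianReal (μ := 0) (v := 1) one_ne_zero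
  let ν : ℕ → ProbabilityMeasure ℝ := fun n =>
    ⟨(Measure.pi fun i => poissonMeasure (r n i)).map fun y => ∑ i, c n i * ((y i : ℝ) - r n i),
      Measure.isProbabilityMeasure_map Measurable.of_discrete.aemeasurable⟩
  let ν₀ : ProbabilityMeasure ℝ := ⟨gaussianReal 0 1, inferInstance⟩
  have hν : Tendsto ν atTop (𝓝 ν₀) :=
    ProbabilityMeasure.tendsto_iff_tendsto_charFun.2
      (tendsto_charFun_weighted_poisson_sum hd hsum hc)
  have hfr : (ν₀ : Measure ℝ) (frontier (Set.Icc (-x) x)) = 0 := by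
    change gaussianReal 0 1 (frontier (Set.Icc (-x) x)) = 0
    refine Set.Finite.measure_zero ?_ _
    by_cases h : -x ≤ x
    · rw [frontier_Icc h]; simp
    · simp [Set.Icc_eq_empty h]
  have h := ProbabilityMeasure.tendsto_measure_of_null_frontier_of_tendsto' hν hfr
  have h' := (ENNReal.tendsto_toReal (measure_ne_top _ _)).comp h
  refine h'.congr fun n => ?_
  simp only [Function.comp_apply, ν, ProbabilityMeasure.coe_mk, Measure.real]
  rw [Measure.map_apply Measurable.of_discrete measurableSet_Icc]
  congr 2
  ext y
  simp [abs_le]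

lemma tendsto_weighted_poisson_sum_standardized (hd : Tendsto d atTop (𝓝 0))
    (hpos : ∀ᶠ n in atTop, 0 < ∑ i, c n i ^ 2 * (r n i : ℝ))
    (hc : ∀ᶠ n in atTop, ∀ i, c n i ^ 2 ≤ d n * ∑ i, c n i ^ 2 * (r n i : ℝ)) (x : ℝ) :
    Tendsto (fun n => (Measure.pi fun i => poissonMeasure (r n i)).real
        {y | |∑ i, c n i * ((y i : ℝ) - r n i)| ≤ x * √(∑ i, c n i ^ 2 * (r n i : ℝ))}) atTop
      (𝓝 ((gaussianReal 0 1).real (Set.Icc (-x) x))) := by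
  have h := tendsto_weighted_poisson_sum_normalized (r := r) (d := d)
    (c := fun n i => c n i / √(∑ i, c n i ^ 2 * (r n i : ℝ))) hd ?_ ?_ x
  · refine h.congr' ?_
    filter_upwards [hpos] with n hn
    congr 1
    ext y
    have hs := Real.sqrt_pos.2 hn
    simp_rw [Set.mem_ofPred_eq, div_mul_eq_mul_div, ← Finset.sum_div]
    rw [abs_div, abs_of_pos hs, div_le_iff₀ hs]
  · filter_upwards [hpos] with n hn
    simp_rw [div_pow, Real.sq_sqrt hn.le, div_mul_eq_mul_div, ← Finset.sum_div]
    exact div_self hn.ne'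
  · filter_upwards [hpos, hc] with n hn hc i
    rw [div_pow, Real.sq_sqrt hn.le, div_le_iff₀ hn]
    exact hc i

/-- Coverage of the self-normalized interval for a weighted Poisson sum. -/
theorem tendsto_weighted_poisson_sum_studentized (hd : Tendsto d atTop (𝓝 0))
    (hpos : ∀ᶠ n in atTop, 0 < ∑ i, c n i ^ 2 * (r n i : ℝ))
    (hc : ∀ᶠ n in atTop, ∀ i, c n i ^ 2 ≤ d n * ∑ i, c n i ^ 2 * (r n i : ℝ))
    {q : ℝ} (hq : 0 < q) :
    Tendsto (fun n => (Measure.pi fun i => poissonMeasure (r n i)).real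
        {y | |∑ i, c n i * ((y i : ℝ) - r n i)| ≤ q * √(∑ i, c n i ^ 2 * (y i : ℝ))}) atTop
      (𝓝 ((gaussianReal 0 1).real (Set.Icc (-q) q))) := by
  set g : ℝ → ℝ := fun x => (gaussianReal 0 1).real (Set.Icc (-x) x) with hg
  -- Continuity of the limiting coverage in the half-width is what lets the slack `η` vanish at the
  -- end.
  have hgc : Tendsto g (𝓝 q) (𝓝 (g q)) := by
    have h1 : Tendsto (fun x => 2 * cdf (gaussianReal 0 1) x - 1) (𝓝 q)
        (𝓝 (2 * cdf (gaussianReal 0 1) q - 1)) :=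
      ((continuous_cdf_stdGaussian.const_mul 2).sub continuous_const).tendsto q
    rw [← gaussianReal_real_Icc_neg_self hq.le] at h1
    refine h1.congr' ?_
    filter_upwards [lt_mem_nhds hq] with x hx
    exact (gaussianReal_real_Icc_neg_self hx.le).symm
  have hη0 : Tendsto (fun η : ℝ => η) (𝓝[>] 0) (𝓝 0) := tendsto_id.mono_left nhdsWithin_le_nhds
  have hup : Tendsto (fun η : ℝ => g (q * (1 + η))) (𝓝[>] 0) (𝓝 (g q)) :=
    hgc.comp (by simpa using (hη0.const_add 1).const_mul q)
  have hlow : Tendsto (fun η : ℝ => g (q * (1 - η))) (𝓝[>] 0) (𝓝 (g q)) :=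
    hgc.comp (by simpa using (hη0.const_sub 1).const_mul q)
  have hη1 : ∀ᶠ η : ℝ in 𝓝[>] 0, 0 < η ∧ η < 1 := by
    filter_upwards [Ioo_mem_nhdsGT (one_pos (α := ℝ))] with η h using h
  have hdev : ∀ η : ℝ, Tendsto (fun n => d n / η ^ 2) atTop (𝓝 0) := fun η => by
    simpa using hd.div_const (η ^ 2)
  -- comparison of the studentized event with standardized events, outside a small set
  have key : ∀ η : ℝ, 0 < η → η < 1 → ∀ᶠ n in atTop,
      (Measure.pi fun i => poissonMeasure (r n i)).real
        {y | |∑ i, c n i * ((y i : ℝ) - r n i)| ≤ q * √(∑ i, c n i ^ 2 * (y i : ℝ))}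
      ≤ (Measure.pi fun i => poissonMeasure (r n i)).real
        {y | |∑ i, c n i * ((y i : ℝ) - r n i)| ≤
          q * (1 + η) * √(∑ i, c n i ^ 2 * (r n i : ℝ))} + d n / η ^ 2 ∧
      (Measure.pi fun i => poissonMeasure (r n i)).real
        {y | |∑ i, c n i * ((y i : ℝ) - r n i)| ≤
          q * (1 - η) * √(∑ i, c n i ^ 2 * (r n i : ℝ))} - d n / η ^ 2
      ≤ (Measure.pi fun i => poissonMeasure (r n i)).real
        {y | |∑ i, c n i * ((y i : ℝ) - r n i)| ≤ q * √(∑ i, c n i ^ 2 * (y i : ℝ))} := by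
    intro η hη hη1
    filter_upwards [hpos, hc] with n hn hcn
    have hdev := weighted_poisson_sum_concentration (r n) (c n) hn hcn hη
    set V := ∑ i, c n i ^ 2 * (r n i : ℝ)
    set μ := Measure.pi fun i => poissonMeasure (r n i)
    constructor
    · refine le_trans ?_ (add_le_add_right hdev _)
      refine le_trans (measureReal_mono ?_) (measureReal_union_le _ _)
      intro y hy
      by_cases hb : η * V ≤ |∑ i, c n i ^ 2 * (y i : ℝ) - V|
      · exact Or.inr hb
      · refine Or.inl ?_
        rw [Set.mem_ofPred_eq] at hy ⊢
        refine le_trans hy ?_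
        rw [not_le, abs_lt] at hb
        rw [mul_assoc]
        gcongr
        refine Real.sqrt_le_iff.2 ⟨by positivity, ?_⟩
        rw [mul_pow, Real.sq_sqrt hn.le]
        -- Off the exceptional set the estimate is below `(1 + η) * V ≤ (1 + η) ^ 2 * V`.
        nlinarith [mul_pos hη hn, mul_pos (mul_pos hη hη) hn]
    · rw [sub_le_iff_le_add]
      refine le_trans ?_ (add_le_add_right hdev _)
      refine le_trans (measureReal_mono ?_) (measureReal_union_le _ _)
      intro y hy
      by_cases hb : η * V ≤ |∑ i, c n i ^ 2 * (y i : ℝ) - V|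
      · exact Or.inr hb
      · refine Or.inl ?_
        rw [Set.mem_ofPred_eq] at hy ⊢
        refine le_trans hy ?_
        rw [not_le, abs_lt] at hb
        rw [mul_assoc]
        gcongr
        refine Real.le_sqrt_of_sq_le ?_
        rw [mul_pow, Real.sq_sqrt hn.le]
        -- Here `(1 - η) ^ 2 * V ≤ (1 - η) * V`, which needs `η < 1`.
        nlinarith [mul_pos hη hn, mul_pos (mul_pos hη (sub_pos.2 hη1)) hn]
  -- The slack `η` is fixed before `n` grows, so the error `d n / η ^ 2` still tends to zero.
  rw [tendsto_order]
  constructor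
  · intro b hb
    obtain ⟨η, hη, hpos', hlt⟩ := ((hlow.eventually_const_lt hb).and hη1).exists
    have h1 := (tendsto_weighted_poisson_sum_standardized hd hpos hc (q * (1 - η))).sub (hdev η)
    rw [sub_zero] at h1
    filter_upwards [key η hpos' hlt, h1.eventually_const_lt hη] with n hk hn
    exact hn.trans_le hk.2
  · intro b hb
    obtain ⟨η, hη, hpos', hlt⟩ := ((hup.eventually_lt_const hb).and hη1).exists
    have h1 := (tendsto_weighted_poisson_sum_standardized hd hpos hc (q * (1 + η))).add (hdev η)
    rw [add_zero] at h1
    filter_upwards [key η hpos' hlt, h1.eventually_lt_const hη] with n hk hn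
    exact hk.1.trans_lt hn

end TriangularArray

/-! ### Binomial thinning of a Poisson network -/

/-- The binomial coefficient cancels `(k + j)!`, and `exp (-m)` splits since `r + s = m`: retained
and removed counts are independent. -/
lemma poissonMeasure_mul_binomial {m r s : ℝ≥0} {ε : unitInterval} (hr : (r : ℝ) = ε * m)
    (hs : (s : ℝ) = (1 - ε) * m) (k j : ℕ) :
    poissonMeasure m {k + j} * binomial (k + j) ε {k}
      = poissonMeasure r {k} * poissonMeasure s {j} := by
  have hε : (0 : ℝ) ≤ 1 - ε := sub_nonneg.2 ε.2.2
  have hε' : (0 : ℝ) ≤ ε := ε.2.1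
  rw [poissonMeasure_singleton, poissonMeasure_singleton, poissonMeasure_singleton,
    binomial_singleton, ← ENNReal.ofReal_mul (by positivity), ← ENNReal.ofReal_mul (by positivity)]
  congr 1
  have hexp : Real.exp (-m) = Real.exp (-r) * Real.exp (-s) := by
    rw [← Real.exp_add]
    congr 1
    rw [hr, hs]
    ring
  have hch : ((k + j).choose k : ℝ) * k.factorial * j.factorial = (k + j).factorial := by
    rw [Nat.choose_symm_add]
    exact_mod_cast Nat.add_choose_mul_factorial_mul_factorial k j
  have h1 : (k.factorial : ℝ) ≠ 0 := by positivity
  have h2 : (j.factorial : ℝ) ≠ 0 := by positivity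
  have h3 : ((k + j).factorial : ℝ) ≠ 0 := by positivity
  rw [Nat.add_sub_cancel_left, hexp, hr, hs, mul_pow, mul_pow, pow_add, div_mul_eq_mul_div,
    div_mul_div_comm, div_eq_div_iff h3 (mul_ne_zero h1 h2), ← hch]
  ring

section Thinning

variable {Ω : Type*} [MeasurableSpace Ω] {P : Measure Ω} [IsProbabilityMeasure P] {n : ℕ}
  {M : Fin n → Fin n → ℝ≥0} {A Atr : Ω → Network n} {ε : unitInterval}

lemma NetworkInference.IsPoissonNetwork.measure_eq (hA : IsPoissonNetwork P A M) (b : Network n) :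
    P {ω | A ω = b} = ∏ e : Fin n × Fin n, poissonMeasure (M e.1 e.2) {b e.1 e.2} := by
  have hm : ∀ e : Fin n × Fin n, Measurable fun ω => A ω e.1 e.2 := fun e =>
    (measurable_pi_apply e.2).comp ((measurable_pi_apply e.1).comp hA.measurable)
  have h := (iIndepFun_iff_map_fun_eq_pi_map fun e => (hm e).aemeasurable).1 hA.indep
  have h2 : P {ω | A ω = b}
      = P.map (fun ω (e : Fin n × Fin n) => A ω e.1 e.2) {fun e => b e.1 e.2} := by
    rw [Measure.map_apply (measurable_pi_lambda _ hm) (measurableSet_singleton _)]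
    congr 1
    ext ω
    simp [funext_iff]
  rw [h2, h, Measure.pi_singleton]
  exact Finset.prod_congr rfl fun e _ => by rw [(hA.law e.1 e.2).map_eq]

lemma NetworkInference.IsPoissonNetwork.measure_inter_eq (hA : IsPoissonNetwork P A M)
    (hAtr : IsBinomialThinning P ε A Atr) (b t : Network n) :
    P ({ω | A ω = b} ∩ {ω | Atr ω = t}) = ∏ e : Fin n × Fin n,
      (poissonMeasure (M e.1 e.2) {b e.1 e.2} * binomial (b e.1 e.2) ε {t e.1 e.2}) := by
  have hms : MeasurableSet {ω | A ω = b} := hA.measurable (measurableSet_singleton b)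
  rw [Finset.prod_mul_distrib, ← hA.measure_eq]
  by_cases h0 : P {ω | A ω = b} = 0
  · rw [h0, zero_mul]
    exact measure_mono_null Set.inter_subset_left h0
  · rw [Fintype.prod_prod_type, ← hAtr.law b t h0, mul_comm, cond_mul_eq_inter hms]

/-- The case split guards against truncated subtraction: only networks dominating `t` are reachable.
-/
lemma map_add_pi_singleton (t b : Network n) (r : Fin n × Fin n → ℝ≥0) :
    ((Measure.pi fun e => poissonMeasure (r e)).map
      fun (y : Fin n × Fin n → ℕ) (i j : Fin n) => t i j + y (i, j)) {b}
      = if ∀ e : Fin n × Fin n, t e.1 e.2 ≤ b e.1 e.2 then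
          ∏ e : Fin n × Fin n, poissonMeasure (r e) {b e.1 e.2 - t e.1 e.2} else 0 := by
  rw [Measure.map_apply .of_discrete (measurableSet_singleton _)]
  split_ifs with h
  · rw [← Measure.pi_singleton]
    congr 1
    ext y
    simp only [Set.mem_preimage, Set.mem_singleton_iff, funext_iff, Prod.forall] at h ⊢
    exact forall₂_congr fun i j => by have := h i j; omega
  · convert measure_empty (μ := Measure.pi fun e => poissonMeasure (r e))
    rw [Set.eq_empty_iff_forall_notMem]
    rintro y rfl
    exact h fun e => Nat.le_add_right _ _

/-- The first factor depends on `t` alone, so it drops out on conditioning. If some edge of `t`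
exceeds that of `b`, both sides vanish, the left one through a zero binomial coefficient. -/
lemma NetworkInference.IsPoissonNetwork.measure_inter_eq_mul (hA : IsPoissonNetwork P A M)
    (hAtr : IsBinomialThinning P ε A Atr) {r : Fin n × Fin n → ℝ≥0}
    (hr : ∀ e, (r e : ℝ) = (1 - ε) * M e.1 e.2) (b t : Network n) :
    P ({ω | A ω = b} ∩ {ω | Atr ω = t}) =
      (∏ e : Fin n × Fin n, poissonMeasure (unitInterval.toNNReal ε * M e.1 e.2) {t e.1 e.2})
      * ((Measure.pi fun e => poissonMeasure (r e)).map
        fun (y : Fin n × Fin n → ℕ) (i j : Fin n) => t i j + y (i, j)) {b} := by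
  rw [hA.measure_inter_eq hAtr, map_add_pi_singleton]
  split_ifs with h
  · rw [← Finset.prod_mul_distrib]
    refine Finset.prod_congr rfl fun e _ => ?_
    rw [← poissonMeasure_mul_binomial (by simp) (hr e), Nat.add_sub_cancel' (h e)]
  · push Not at h
    obtain ⟨e, he⟩ := h
    rw [mul_zero]
    refine Finset.prod_eq_zero (Finset.mem_univ e) ?_
    rw [binomial_singleton, Nat.choose_eq_zero_of_lt he]
    simp

/-- Given the train network and auxiliary randomness, the test network has independent Poisson
edges. -/
theorem NetworkInference.IsPoissonNetwork.map_cond_thinning (hA : IsPoissonNetwork P A M)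
    (hAtr : IsBinomialThinning P ε A Atr) {S : Type*} [MeasurableSpace S] {W : Ω → S}
    (hW : Measurable W) (hindep : IndepFun W (fun ω => (A ω, Atr ω)) P)
    {r : Fin n × Fin n → ℝ≥0} (hr : ∀ e, (r e : ℝ) = (1 - ε) * M e.1 e.2)
    {t : Network n} {C : Set S} (hC : MeasurableSet C)
    (hne : P {ω | Atr ω = t ∧ W ω ∈ C} ≠ 0) :
    (cond P {ω | Atr ω = t ∧ W ω ∈ C}).map A = (Measure.pi fun e => poissonMeasure (r e)).map
        fun (y : Fin n × Fin n → ℕ) (i j : Fin n) => t i j + y (i, j) := by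
  set E := {ω | Atr ω = t ∧ W ω ∈ C} with hE
  set ν := (Measure.pi fun e => poissonMeasure (r e)).map
        fun (y : Fin n × Fin n → ℕ) (i j : Fin n) => t i j + y (i, j) with hν
  have hEm : MeasurableSet E := (hAtr.measurable (measurableSet_singleton t)).inter (hW hC)
  have hνp : IsProbabilityMeasure ν := Measure.isProbabilityMeasure_map .of_discrete
  have hcp : IsProbabilityMeasure (cond P E) := cond_isProbabilityMeasure hne
  have hmp : IsProbabilityMeasure ((cond P E).map A) :=
    Measure.isProbabilityMeasure_map hA.measurable.aemeasurable
  -- Proportionality suffices, since both sides are probability measures; this avoids computing `P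
  -- E`.
  obtain ⟨k, hk⟩ : ∃ k : ℝ≥0∞, (cond P E).map A = k • ν := by
    refine ⟨(P E)⁻¹ * (P (W ⁻¹' C) * ∏ e : Fin n × Fin n,
      poissonMeasure (unitInterval.toNNReal ε * M e.1 e.2) {t e.1 e.2}), ?_⟩
    refine Measure.ext_of_singleton fun b => ?_
    have hset : E ∩ A ⁻¹' {b} = W ⁻¹' C ∩ (fun ω => (A ω, Atr ω)) ⁻¹' {(b, t)} := by
      ext ω
      simp only [hE, Set.mem_inter_iff, Set.mem_ofPred_eq, Set.mem_preimage, Set.mem_singleton_iff,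
        Prod.mk.injEq]
      tauto
    have hset2 : (fun ω => (A ω, Atr ω)) ⁻¹' {(b, t)} = {ω | A ω = b} ∩ {ω | Atr ω = t} := by
      ext ω
      simp
    rw [Measure.map_apply hA.measurable (measurableSet_singleton b), cond_apply hEm, hset,
      hindep.measure_inter_preimage_eq_mul _ _ hC (measurableSet_singleton _), hset2,
      hA.measure_inter_eq_mul hAtr hr, Measure.smul_apply, smul_eq_mul]
    ring
  have h1 : k = 1 := by
    have := congrArg (fun m => m Set.univ) hk
    simpa using this.symm
  rw [hk, h1, one_smul]

omit [IsProbabilityMeasure P] in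
lemma NetworkInference.IsPoissonNetwork.meanMatrix_eq (hA : IsPoissonNetwork P A M) :
    meanMatrix P A = Matrix.of fun i j => (M i j : ℝ) := by
  ext i j
  simp only [meanMatrix, Matrix.of_apply]
  rw [← integral_natCast_poissonMeasure, ← (hA.law i j).map_eq,
    integral_map (hA.law i j).aemeasurable Measurable.of_discrete.aestronglyMeasurable]

end Thinning

/-! ### Block averages as weighted edge sums -/

section Blocks

variable {n K : ℕ} {Z : Matrix (Fin n) (Fin K) ℝ} {κ : Fin n → Fin K}

lemma NetworkInference.IsMembershipMatrix.exists_label (hZ : IsMembershipMatrix Z) :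
    ∃ κ : Fin n → Fin K, ∀ i k, Z i k = if κ i = k then 1 else 0 := by
  choose κ hκ hκu using hZ.2
  refine ⟨κ, fun i k => ?_⟩
  split_ifs with h
  · rw [← h, hκ i]
  · exact (hZ.1 i k).resolve_right fun h1 => h (hκu i k h1).symm

lemma block_eq_product (hκ : ∀ i k, Z i k = if κ i = k then 1 else 0) (k l : Fin K) :
    block Z k l = Finset.univ.filter (κ · = k) ×ˢ Finset.univ.filter (κ · = l) := by
  ext e
  simp [block, hκ]

lemma mem_block_iff (hκ : ∀ i k, Z i k = if κ i = k then 1 else 0) (k l : Fin K)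
    (e : Fin n × Fin n) : e ∈ block Z k l ↔ κ e.1 = k ∧ κ e.2 = l := by
  simp [block, hκ]

lemma card_block_le (Z : Matrix (Fin n) (Fin K) ℝ) (k l : Fin K) :
    ((block Z k l).card : ℝ) ≤ (n : ℝ) ^ 2 := by
  have h := (block Z k l).card_le_univ
  rw [Fintype.card_prod, Fintype.card_fin, ← pow_two] at h
  exact_mod_cast h

lemma transpose_mul_self_eq_diagonal (hκ : ∀ i k, Z i k = if κ i = k then 1 else 0) :
    Zᵀ * Z = Matrix.diagonal fun k => ((Finset.univ.filter (κ · = k)).card : ℝ) := by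
  ext k l
  simp only [Matrix.mul_apply, Matrix.transpose_apply, hκ, Matrix.diagonal_apply]
  split_ifs with h
  · subst h
    rw [Finset.card_filter, Nat.cast_sum]
    exact Finset.sum_congr rfl fun i _ => by split_ifs <;> simp
  · refine Finset.sum_eq_zero fun i _ => ?_
    split_ifs with h1 h2 <;> simp_all

lemma transpose_mul_mul_apply (hκ : ∀ i k, Z i k = if κ i = k then 1 else 0)
    (X : Matrix (Fin n) (Fin n) ℝ) (k l : Fin K) :
    (Zᵀ * X * Z) k l = ∑ e ∈ block Z k l, X e.1 e.2 := by
  rw [block_eq_product hκ, Finset.sum_product_right]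
  simp [Matrix.mul_apply, hκ, Finset.sum_filter]

/-- `Zᵀ * Z` is diagonal with the community sizes, and the size of a block is the product of two of
them. Nonempty diagonal blocks make it invertible. -/
lemma blockProjection_eq_BHat (hZ : IsMembershipMatrix Z)
    (hne : ∀ k l, (block Z k l).Nonempty) (X : Matrix (Fin n) (Fin n) ℝ) :
    blockProjection Z X = BHat X Z := by
  obtain ⟨κ, hκ⟩ := hZ.exists_label
  have hN : ∀ k, ((Finset.univ.filter (κ · = k)).card : ℝ) ≠ 0 := by
    intro k
    obtain ⟨e, he⟩ := hne k k
    rw [mem_block_iff hκ] at he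
    exact_mod_cast (Finset.card_pos.2 ⟨e.1, by simp [he.1]⟩).ne'
  have hinv : (Zᵀ * Z)⁻¹
      = Matrix.diagonal fun k => ((Finset.univ.filter (κ · = k)).card : ℝ)⁻¹ := by
    refine Matrix.inv_eq_right_inv ?_
    rw [transpose_mul_self_eq_diagonal hκ, Matrix.diagonal_mul_diagonal, ← Matrix.diagonal_one]
    congr 1
    ext k
    exact mul_inv_cancel₀ (hN k)
  ext k l
  rw [blockProjection, hinv, Matrix.mul_diagonal, Matrix.mul_assoc, Matrix.mul_assoc,
    Matrix.diagonal_mul, ← Matrix.mul_assoc, transpose_mul_mul_apply hκ, BHat, Matrix.of_apply]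
  conv_rhs => rw [block_eq_product hκ, Finset.card_product, ← block_eq_product hκ]
  push_cast
  have h1 := hN k
  have h2 := hN l
  field_simp

/-- The swapped indices reflect that `Matrix.vec` stacks columns, so `p` is (column, row). The
blocks partition the edges. -/
lemma sum_mul_sum_block (hκ : ∀ i k, Z i k = if κ i = k then 1 else 0) (g : Fin K × Fin K → ℝ)
    (x : Fin n × Fin n → ℝ) :
    ∑ p : Fin K × Fin K, g p * ∑ e ∈ block Z p.2 p.1, x e
      = ∑ e : Fin n × Fin n, g (κ e.2, κ e.1) * x e := by
  rw [← Finset.sum_fiberwise Finset.univ fun e : Fin n × Fin n => (κ e.2, κ e.1)]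
  refine Finset.sum_congr rfl fun p _ => ?_
  rw [Finset.mul_sum]
  refine Finset.sum_congr ?_ ?_
  · ext e
    simp [mem_block_iff hκ, Prod.ext_iff, and_comm]
  · intro e he
    rw [← (Finset.mem_filter.1 he).2]

/-- The weight that the estimator `θ̂` gives to an edge of the test network. -/
noncomputable def edgeWeight (δ : ℝ) (Z : Matrix (Fin n) (Fin K) ℝ) (κ : Fin n → Fin K)
    (u : EuclideanSpace ℝ (Fin K × Fin K)) (e : Fin n × Fin n) : ℝ :=
  (1 - δ)⁻¹ * (u (κ e.2, κ e.1) / ((block Z (κ e.1) (κ e.2)).card : ℝ))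

variable {u : EuclideanSpace ℝ (Fin K × Fin K)} {δ : ℝ}

lemma thetaHat_eq_sum (hZ : IsMembershipMatrix Z)
    (hκ : ∀ i k, Z i k = if κ i = k then 1 else 0)
    (hne : ∀ k l, (block Z k l).Nonempty) (X : Matrix (Fin n) (Fin n) ℝ) :
    thetaHat δ X Z u = ∑ e, edgeWeight δ Z κ u e * X e.1 e.2 := by
  have h := sum_mul_sum_block hκ (fun p => (1 - δ)⁻¹ * (u p / ((block Z p.2 p.1).card : ℝ)))
    (fun e => X e.1 e.2)
  simp only [edgeWeight]
  rw [← h, thetaHat, blockProjection_eq_BHat hZ hne, dotProduct, Finset.mul_sum]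
  refine Finset.sum_congr rfl fun p _ => ?_
  simp only [Matrix.vec, BHat, Matrix.of_apply]
  ring

lemma theta_eq_sum (hZ : IsMembershipMatrix Z)
    (hκ : ∀ i k, Z i k = if κ i = k then 1 else 0)
    (hne : ∀ k l, (block Z k l).Nonempty) (hδ : δ < 1) (X : Matrix (Fin n) (Fin n) ℝ) :
    theta X Z u = ∑ e, edgeWeight δ Z κ u e * ((1 - δ) * X e.1 e.2) := by
  have h := thetaHat_eq_sum (δ := δ) (u := u) hZ hκ hne X
  have hδ' : 1 - δ ≠ 0 := (sub_pos.2 hδ).ne'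
  have h2 : theta X Z u = (1 - δ) * thetaHat δ X Z u := by
    rw [thetaHat, theta, mul_inv_cancel_left₀ hδ']
  rw [h2, h, Finset.mul_sum]
  exact Finset.sum_congr rfl fun e _ => by ring

lemma sigmaHatSq_eq_sum (hκ : ∀ i k, Z i k = if κ i = k then 1 else 0)
    (X : Matrix (Fin n) (Fin n) ℝ) :
    sigmaHatSq δ X Z u = ∑ e, edgeWeight δ Z κ u e ^ 2 * X e.1 e.2 := by
  have h := sum_mul_sum_block hκ
    (fun p => ((1 - δ)⁻¹ * (u p / ((block Z p.2 p.1).card : ℝ))) ^ 2) (fun e => X e.1 e.2)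
  simp only [edgeWeight]
  rw [← h, sigmaHatSq, dotProduct, Finset.mul_sum]
  refine Finset.sum_congr rfl fun p _ => ?_
  simp only [Matrix.mulVec_diagonal, Matrix.vec, DeltaHat, BHat, Matrix.of_apply, ← inv_pow]
  ring

/-- A block contributes `u p ^ 2` over its size, up to the factor in `δ`, and no block has more than
`n ^ 2` edges. -/
lemma sum_edgeWeight_sq_ge (hκ : ∀ i k, Z i k = if κ i = k then 1 else 0)
    (hne : ∀ k l, (block Z k l).Nonempty) (hu : ‖u‖ = 1) :
    ((1 - δ)⁻¹) ^ 2 / (n : ℝ) ^ 2 ≤ ∑ e, edgeWeight δ Z κ u e ^ 2 := by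
  have h := sum_mul_sum_block hκ
    (fun p => ((1 - δ)⁻¹ * (u p / ((block Z p.2 p.1).card : ℝ))) ^ 2) (fun _ => 1)
  simp only [mul_one] at h
  simp only [edgeWeight]
  rw [← h]
  have hu2 : ∑ p, u p ^ 2 = 1 := by
    rw [← EuclideanSpace.real_norm_sq_eq, hu, one_pow]
  calc ((1 - δ)⁻¹) ^ 2 / (n : ℝ) ^ 2 = ∑ p, ((1 - δ)⁻¹) ^ 2 / (n : ℝ) ^ 2 * u p ^ 2 := by
        rw [← Finset.mul_sum, hu2, mul_one]
    _ ≤ _ := by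
        refine Finset.sum_le_sum fun p _ => ?_
        have hc : (0 : ℝ) < (block Z p.2 p.1).card := by
          exact_mod_cast Finset.card_pos.2 (hne _ _)
        have hle := card_block_le Z p.2 p.1
        simp only [Finset.sum_const, nsmul_eq_mul, mul_one]
        calc ((1 - δ)⁻¹) ^ 2 / (n : ℝ) ^ 2 * u p ^ 2
            ≤ ((1 - δ)⁻¹) ^ 2 / (block Z p.2 p.1).card * u p ^ 2 := by gcongr
          _ = _ := by field_simp

lemma edgeWeight_sq_le {ρ : ℝ} (hρ : ∀ k l, ((block Z k l).card : ℝ)⁻¹ ≤ ρ) (hu : ‖u‖ = 1)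
    (e : Fin n × Fin n) : edgeWeight δ Z κ u e ^ 2 ≤ ((1 - δ)⁻¹) ^ 2 * ρ ^ 2 := by
  have hu1 : |u (κ e.2, κ e.1)| ≤ 1 := by
    rw [← hu]
    exact PiLp.norm_apply_le u _
  have h1 : u (κ e.2, κ e.1) ^ 2 ≤ 1 := (sq_le_one_iff_abs_le_one _).2 hu1
  rw [edgeWeight, mul_pow, div_eq_mul_inv, mul_pow]
  gcongr
  calc _ ≤ 1 * ρ ^ 2 := by
        gcongr
        exact hρ _ _
    _ = _ := one_mul _

end Blocks

/-- Each squared edge weight is a small fraction of the variance of the weighted edge sum. -/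
lemma edgeWeight_sq_le_mul_sum {n K : ℕ} {Z : Matrix (Fin n) (Fin K) ℝ} {κ : Fin n → Fin K}
    {u : EuclideanSpace ℝ (Fin K × Fin K)} {δ ρ m : ℝ} {r : Fin n × Fin n → ℝ≥0}
    (hκ : ∀ i k, Z i k = if κ i = k then 1 else 0) (hne : ∀ k l, (block Z k l).Nonempty)
    (hu : ‖u‖ = 1) (hδ : δ < 1) (hn : 0 < n) (hm : 0 < m) (hr : ∀ e, m ≤ r e)
    (hρ : ∀ k l, ((block Z k l).card : ℝ)⁻¹ ≤ ρ) :
    0 < ∑ e, edgeWeight δ Z κ u e ^ 2 * (r e : ℝ) ∧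
    ∀ e, edgeWeight δ Z κ u e ^ 2 ≤
      (ρ * n) ^ 2 / m * ∑ e, edgeWeight δ Z κ u e ^ 2 * (r e : ℝ) := by
  have hδ' : 0 < (1 - δ)⁻¹ := inv_pos.2 (sub_pos.2 hδ)
  have hn' : (0 : ℝ) < n := by exact_mod_cast hn
  have hV : m * (((1 - δ)⁻¹) ^ 2 / (n : ℝ) ^ 2) ≤ ∑ e, edgeWeight δ Z κ u e ^ 2 * (r e : ℝ) := by
    calc _ ≤ m * ∑ e, edgeWeight δ Z κ u e ^ 2 := by
          gcongr
          exact sum_edgeWeight_sq_ge hκ hne hu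
      _ ≤ _ := by
          rw [Finset.mul_sum]
          refine Finset.sum_le_sum fun e _ => ?_
          rw [mul_comm]
          gcongr
          exact hr e
  refine ⟨lt_of_lt_of_le (by positivity) hV, fun e => ?_⟩
  refine (edgeWeight_sq_le hρ hu e).trans ?_
  -- The factor `(ρ * n) ^ 2 / m` is the ratio of the upper bound on a squared weight to the lower
  -- bound `hV`.
  calc _ = (ρ * n) ^ 2 / m * (m * (((1 - δ)⁻¹) ^ 2 / (n : ℝ) ^ 2)) := by field_simp
    _ ≤ _ := by gcongr

/-! ### Coverage in terms of independent Poisson edges -/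

lemma NetworkInference.mem_waldInterval_iff {n K : ℕ} {Z : Matrix (Fin n) (Fin K) ℝ}
    {κ : Fin n → Fin K} {u : EuclideanSpace ℝ (Fin K × Fin K)} {δ α : ℝ}
    {r : Fin n × Fin n → ℝ≥0} {m : Fin n → Fin n → ℝ≥0} (hZ : IsMembershipMatrix Z)
    (hκ : ∀ i k, Z i k = if κ i = k then 1 else 0) (hne : ∀ k l, (block Z k l).Nonempty)
    (hδ : δ < 1) (hr : ∀ e, (r e : ℝ) = (1 - δ) * m e.1 e.2) (t : Network n)
    (y : Fin n × Fin n → ℕ) :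
    theta (Matrix.of fun i j => (m i j : ℝ)) Z u ∈
        waldInterval δ α (testMatrix (fun i j => t i j + y (i, j)) t) Z u ↔
      |∑ e, edgeWeight δ Z κ u e * ((y e : ℝ) - r e)| ≤
        stdNormalQuantile (1 - α / 2) * √(∑ e, edgeWeight δ Z κ u e ^ 2 * (y e : ℝ)) := by
  have hY : testMatrix (fun i j => t i j + y (i, j)) t
      = Matrix.of fun i j => (y (i, j) : ℝ) := by
    ext i j
    simp [testMatrix]
  rw [hY, waldInterval, theta_eq_sum hZ hκ hne hδ, thetaHat_eq_sum hZ hκ hne,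
    sigmaHatSq_eq_sum hκ]
  simp only [Matrix.of_apply, ← hr, Prod.mk.eta, mul_sub, Finset.sum_sub_distrib]
  rw [Set.mem_Icc, abs_le]
  constructor <;> rintro ⟨h1, h2⟩ <;> constructor <;> linarith

/-- The conditional coverage probability, expressed through independent Poisson edges. -/
lemma NetworkInference.IsPoissonNetwork.cond_coverage_eq {Ω S : Type*} [MeasurableSpace Ω]
    [MeasurableSpace S] {P : Measure Ω} [IsProbabilityMeasure P] {n K : ℕ} {ε : unitInterval}
    {M : Fin n → Fin n → ℝ≥0} {A Atr : Ω → Network n} {W : Ω → S}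
    {Zhat : Network n → S → Matrix (Fin n) (Fin K) ℝ}
    {u : Network n → Matrix (Fin n) (Fin K) ℝ → EuclideanSpace ℝ (Fin K × Fin K)}
    {t : Network n} {Z : Matrix (Fin n) (Fin K) ℝ} {κ : Fin n → Fin K} {r : Fin n × Fin n → ℝ≥0}
    (hA : IsPoissonNetwork P A M) (hAtr : IsBinomialThinning P ε A Atr) (hW : Measurable W)
    (hWindep : IndepFun W (fun ω => (A ω, Atr ω)) P)
    (hZhat_meas : MeasurableSet {w | Zhat t w = Z}) (hZ : IsMembershipMatrix Z)
    (hpos : P {ω | Atr ω = t ∧ Zhat (Atr ω) (W ω) = Z} ≠ 0)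
    (hκ : ∀ i k, Z i k = if κ i = k then 1 else 0) (hne : ∀ k l, (block Z k l).Nonempty)
    (hε : (ε : ℝ) < 1) (hr : ∀ e, (r e : ℝ) = (1 - (ε : ℝ)) * M e.1 e.2) (α : ℝ) :
    (cond P {ω | Atr ω = t ∧ Zhat (Atr ω) (W ω) = Z}).real
      {ω | theta (meanMatrix P A) (Zhat (Atr ω) (W ω)) (u (Atr ω) (Zhat (Atr ω) (W ω))) ∈
        waldInterval ε α (testMatrix (A ω) (Atr ω)) (Zhat (Atr ω) (W ω))
          (u (Atr ω) (Zhat (Atr ω) (W ω)))}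
    = (Measure.pi fun e => poissonMeasure (r e)).real
      {y | |∑ e, edgeWeight ε Z κ (u t Z) e * ((y e : ℝ) - r e)| ≤
        stdNormalQuantile (1 - α / 2) * √(∑ e, edgeWeight ε Z κ (u t Z) e ^ 2 * (y e : ℝ))} := by
  set E := {ω | Atr ω = t ∧ Zhat (Atr ω) (W ω) = Z} with hE
  -- Once the train network is fixed, the condition on the communities concerns only `W`, as the
  -- thinning theorem requires.
  have hE' : E = {ω | Atr ω = t ∧ W ω ∈ {w | Zhat t w = Z}} := by
    ext ω
    simp only [hE, Set.mem_ofPred_eq]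
    exact and_congr_right fun h => by rw [h]
  have hEm : MeasurableSet E := by
    rw [hE']
    exact (hAtr.measurable (measurableSet_singleton _)).inter (hW hZhat_meas)
  have hlaw := hA.map_cond_thinning hAtr hW hWindep hr hZhat_meas (hE' ▸ hpos)
  rw [← hE'] at hlaw
  let B : Set (Network n) := {b | theta (Matrix.of fun i j => (M i j : ℝ)) Z (u t Z) ∈
    waldInterval ε α (testMatrix b t) Z (u t Z)}
  calc _ = (cond P E).real (A ⁻¹' B) := by
        refine measureReal_congr ?_
        rw [Filter.eventuallyEq_set]
        filter_upwards [ae_cond_mem hEm] with ω hω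
        simp only [B, Set.mem_preimage, Set.mem_ofPred_eq]
        rw [hω.2, hω.1, hA.meanMatrix_eq]
    _ = ((Measure.pi fun e => poissonMeasure (r e)).map
        fun (y : Fin n × Fin n → ℕ) (i j : Fin n) => t i j + y (i, j)).real B := by
        rw [← hlaw, map_measureReal_apply hA.measurable .of_discrete]
    _ = _ := by
        rw [map_measureReal_apply .of_discrete .of_discrete]
        congr 1
        ext y
        exact mem_waldInterval_iff hZ hκ hne hε hr t y

/-- The sum serves as a single `ρ` valid for all blocks, and it inherits the order `n⁻²`. -/
lemma inv_card_block_le_sum {n K : ℕ} (Z : Matrix (Fin n) (Fin K) ℝ) (k l : Fin K) :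
    ((block Z k l).card : ℝ)⁻¹ ≤ ∑ p : Fin K × Fin K, ((block Z p.1 p.2).card : ℝ)⁻¹ := by
  have h := Finset.single_le_sum (f := fun p : Fin K × Fin K => ((block Z p.1 p.2).card : ℝ)⁻¹)
    (s := Finset.univ) (a := (k, l)) (fun p _ => by positivity) (by simp)
  exact h

lemma tendsto_inv_card_block_mul {K : ℕ} {z : ∀ n : ℕ, Matrix (Fin n) (Fin K) ℝ}
    (h : ∀ k l : Fin K,
      (fun n => ((block (z n) k l).card : ℝ)⁻¹) =O[atTop] (fun n : ℕ => ((n : ℝ) ^ 2)⁻¹)) :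
    Tendsto (fun n : ℕ => (∑ p : Fin K × Fin K, ((block (z n) p.1 p.2).card : ℝ)⁻¹) * n)
      atTop (𝓝 0) := by
  have hO : (fun n => ∑ p : Fin K × Fin K, ((block (z n) p.1 p.2).card : ℝ)⁻¹)
      =O[atTop] fun n : ℕ => ((n : ℝ) ^ 2)⁻¹ :=
    IsBigO.fun_sum fun (p : Fin K × Fin K) _ => h p.1 p.2
  refine (hO.mul (isBigO_refl (fun n : ℕ => (n : ℝ)) atTop)).trans_tendsto ?_
  refine tendsto_inv_atTop_nhds_zero_nat.congr' ?_
  filter_upwards [eventually_gt_atTop 0] with n hn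
  have : (n : ℝ) ≠ 0 := by exact_mod_cast hn.ne'
  field_simp

/-- Asymptotic conditional coverage of the interval `[θ̂ ± φ σ̂]`. The estimated membership matrix is
`Zhat n (Atr n ω) (W n ω)`, where `W n` is auxiliary randomness independent of the data (for a
deterministic algorithm, `S n` is a one-point space). The sequences `a` and `z` are the realizations
of the train networks and of the estimated membership matrices on which one conditions. -/
theorem proposition5
    {Ω : ℕ → Type*} [∀ n, MeasurableSpace (Ω n)]
    (P : ∀ n, Measure (Ω n)) [∀ n, IsProbabilityMeasure (P n)]
    (ε : unitInterval) (hε0 : 0 < ε) (hε1 : ε < 1)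
    (α : ℝ) (hα0 : 0 < α) (hα1 : α < 1)
    (N₀ N₁ : ℝ≥0) (hN₀ : 0 < N₀)
    (M : ∀ n, Fin n → Fin n → ℝ≥0) (hM : ∀ n i j, N₀ ≤ M n i j ∧ M n i j ≤ N₁)
    (A Atr : ∀ n, Ω n → Network n)
    (hA : ∀ n, IsPoissonNetwork (P n) (A n) (M n))
    (hAtr : ∀ n, IsBinomialThinning (P n) ε (A n) (Atr n))
    {S : ℕ → Type*} [∀ n, MeasurableSpace (S n)]
    (W : ∀ n, Ω n → S n) (hW : ∀ n, Measurable (W n))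
    (hWindep : ∀ n, IndepFun (W n) (fun ω => (A n ω, Atr n ω)) (P n))
    (K : ℕ) (Zhat : ∀ n, Network n → S n → Matrix (Fin n) (Fin K) ℝ)
    (hZhat : ∀ n t w, IsMembershipMatrix (Zhat n t w))
    (hZhat_meas : ∀ n t z, MeasurableSet {w | Zhat n t w = z})
    (u : ∀ n, Network n → Matrix (Fin n) (Fin K) ℝ → EuclideanSpace ℝ (Fin K × Fin K))
    (hu : ∀ n t z, ‖u n t z‖ = 1)
    (a : ∀ n, Network n) (z : ∀ n, Matrix (Fin n) (Fin K) ℝ)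
    (haz : ∀ n, P n {ω | Atr n ω = a n ∧ Zhat n (Atr n ω) (W n ω) = z n} ≠ 0)
    (hblock : ∀ k l : Fin K,
      (∀ᶠ n in atTop, (block (z n) k l).Nonempty) ∧
      (fun n => ((block (z n) k l).card : ℝ)⁻¹) =O[atTop] (fun n : ℕ => ((n : ℝ) ^ 2)⁻¹)) :
    Tendsto
      (fun n =>
        (cond (P n) {ω | Atr n ω = a n ∧ Zhat n (Atr n ω) (W n ω) = z n}).real
          {ω |
            theta (meanMatrix (P n) (A n)) (Zhat n (Atr n ω) (W n ω))
                (u n (Atr n ω) (Zhat n (Atr n ω) (W n ω))) ∈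
              waldInterval ε α (testMatrix (A n ω) (Atr n ω)) (Zhat n (Atr n ω) (W n ω))
                (u n (Atr n ω) (Zhat n (Atr n ω) (W n ω)))})
      atTop (𝓝 (1 - α)) := by
  have hε1' : (ε : ℝ) < 1 := hε1
  have hε : (0 : ℝ) < 1 - ε := sub_pos.2 hε1'
  -- A realization of positive probability is attained, so it is a value of the estimator.
  have hz : ∀ n, IsMembershipMatrix (z n) := fun n => by
    obtain ⟨ω, -, h⟩ := nonempty_of_measure_ne_zero (haz n)
    exact h ▸ hZhat _ _ _
  choose κ hκ using fun n => (hz n).exists_label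
  obtain ⟨r, hr⟩ : ∃ r : ∀ n, Fin n × Fin n → ℝ≥0,
      ∀ n e, (r n e : ℝ) = (1 - (ε : ℝ)) * M n e.1 e.2 :=
    ⟨fun n e => ⟨(1 - (ε : ℝ)) * M n e.1 e.2, by positivity⟩, fun _ _ => rfl⟩
  have hne : ∀ᶠ n in atTop, ∀ k l, (block (z n) k l).Nonempty := by
    simp_rw [eventually_all]
    exact fun k l => (hblock k l).1
  have hm : 0 < (1 - (ε : ℝ)) * N₀ := mul_pos hε hN₀
  -- This is `d n = (ρ * n) ^ 2 / m` with `m = (1 - ε) * N₀`, the uniform lower bound on the test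
  -- means.
  have hd := ((tendsto_inv_card_block_mul fun k l => (hblock k l).2).pow 2).div_const
    ((1 - (ε : ℝ)) * N₀)
  rw [zero_pow two_ne_zero, zero_div] at hd
  have hmr : ∀ n e, (1 - (ε : ℝ)) * N₀ ≤ r n e := fun n e => by
    rw [hr]
    exact mul_le_mul_of_nonneg_left (NNReal.coe_le_coe.2 (hM n e.1 e.2).1) hε.le
  have hbound := (hne.and (eventually_gt_atTop 0)).mono fun n hn =>
    edgeWeight_sq_le_mul_sum (r := r n) (hκ n) hn.1 (hu n (a n) (z n)) hε1' hn.2 hm (hmr n)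
      (inv_card_block_le_sum (z n))
  have hclt := tendsto_weighted_poisson_sum_studentized hd
    (hbound.mono fun _ h => h.1) (hbound.mono fun _ h => h.2)
    (stdNormalQuantile_pos (p := 1 - α / 2) (by linarith) (by linarith))
  rw [gaussianReal_Icc_stdNormalQuantile hα0 hα1] at hclt
  refine hclt.congr' (hne.mono fun n hn => ?_)
  exact ((hA n).cond_coverage_eq (hAtr n) (hW n) (hWindep n) (hZhat_meas n (a n) (z n)) (hz n)
    (haz n) (hκ n) hn hε1' (hr n) α).symm
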